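/- An affine integer loop is a program $$\textbf{while } B\vec{x}+\vec{b}>\vec{0}\ \textbf{ do }\ \vec{x}\leftarrow A\vec{x}+\vec{a},$$ given by $d\in\mathbb{N}$ with $d\ge 1$, $k\in\mathbb{N}$, $A\in\mathbb{Z}^{d\times d}$, $\vec{a}\in\mathbb{Z}^d$, $B\in\mathbb{Q}^{k\times d}$ and $\vec{b}\in\mathbb{Q}^k$, where the inequality is meant componentwise. Let $f:\mathbb{Z}^d\to\mathbb{Z}^d$, $f(\vec{x})=A\vec{x}+\vec{a}$. The loop is non-terminating if there is a $\vec{c}\in\mathbb{Z}^d$ such that $B f^n(\vec{c})+\vec{b}>\vec{0}$ for all $n\in\mathbb{N}$; otherwise it terminates. The loop is triangular if all entries of $A$ above the main diagonal are zero or all entries of $A$ below the main diagonal are zero. Theorem. Termination of triangular affine integer loops is decidable: there is an algorithm that, given (as finite data) $d,k,A,\vec{a},B,\vec{b}$ of any triangular affine integer loop, always halts and correctly answers whether the loop terminates. -/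

import Mathlib

open scoped Matrix

/-- An affine integer loop `while B x + b > 0 do x ← A x + a` over `d ≥ 1` integer variables,
whose guard is the conjunction of `k` (possibly `k = 0`) strict affine inequalities with rational
coefficients. -/
structure AffineLoop where
  d : ℕ
  d_pos : 1 ≤ d
  k : ℕ
  A : Matrix (Fin d) (Fin d) ℤ
  a : Fin d → ℤ
  B : Matrix (Fin k) (Fin d) ℚ
  b : Fin k → ℚ

namespace AffineLoop

/-- The update `f(x) = A x + a` of the loop. -/
def update (L : AffineLoop) (x : Fin L.d → ℤ) : Fin L.d → ℤ :=
  L.A *ᵥ x + L.a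

/-- The guard `B x + b > 0` of the loop (componentwise). -/
def Guard (L : AffineLoop) (x : Fin L.d → ℤ) : Prop :=
  ∀ i : Fin L.k, 0 < (L.B *ᵥ (fun j => (x j : ℚ)) + L.b) i

/-- `c` witnesses non-termination: the guard holds at `f^n(c)` for every `n`. -/
def IsNonterminationWitness (L : AffineLoop) (c : Fin L.d → ℤ) : Prop :=
  ∀ n : ℕ, L.Guard (L.update^[n] c)

/-- The loop terminates (on all integer inputs). -/
def Terminates (L : AffineLoop) : Prop :=
  ¬ ∃ c : Fin L.d → ℤ, L.IsNonterminationWitness c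

/-- The update matrix is triangular: all entries above the main diagonal are zero (lower
triangular), or all entries below it are zero (upper triangular). -/
def IsTriangular (L : AffineLoop) : Prop :=
  (∀ i j, i < j → L.A i j = 0) ∨ (∀ i j, j < i → L.A i j = 0)

end AffineLoop

/-- The finite data in which loops are presented to an algorithm: the two dimensions `d`, `k`, then
`A` (list of rows), `a`, `B` (list of rows) and `b`, a rational number being given by its numerator
and its denominator in lowest terms. -/
abbrev LoopCode : Type :=
  ℕ × ℕ × List (List ℤ) × List ℤ × List (List (ℤ × ℕ)) × List (ℤ × ℕ)

namespace AffineLoop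

/-- The presentation of a loop as finite data. -/
def code (L : AffineLoop) : LoopCode :=
  (L.d, L.k,
    List.ofFn (fun i => List.ofFn (fun j => L.A i j)),
    List.ofFn L.a,
    List.ofFn (fun i => List.ofFn (fun j => ((L.B i j).num, (L.B i j).den))),
    List.ofFn (fun i => ((L.b i).num, (L.b i).den)))

end AffineLoop

/-! Only eventual behaviour matters: if the guard holds from some step on along an orbit, a later
point of the orbit is a nontermination witness. Split each orbit into even and odd steps. For
triangular `A` the eigenvalues of `A ^ 2` are the squares of the diagonal entries, so along each
half a guard value, cleared of denominators, obeys a linear recurrence whose roots are these squares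
and 1 (from the affine part): all nonnegative integers.

Arrange such roots in nondecreasing order, with enough repetitions, and apply the operators `E - r
i` (`E` the shift) one after another. The initial values of the successive differences are
coordinates of the sequence. Those belonging to root 0 affect finitely many terms only; among the
others the last nonzero one dominates and decides the eventual sign (`eventually_pos_of_lead`,
`exists_lead_of_pos`).

These coordinates are integer affine functions of the starting point. Once the position of the
dominating coordinate is fixed for each guard and parity, the condition is a system of integer
linear equations and inequalities. By `exists_small_solution` a solvable system has a solution
bounded in terms of its coefficients, so searching a finite box suffices, and the search is
primitive recursive. -/

/-! ### Small solutions of systems of integer linear inequalities -/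

/-- One elimination step of the small solution theorem in dimension at most `d` enlarges the
coefficients of a system from at most `M` to at most this number. -/
def eliminationBound (d M : ℕ) : ℕ := 4 * (d + 1) * (M + 1) ^ 3

/-- A bound for a solution of a solvable system of integer linear inequalities in `n ≤ d` unknowns
with coefficients at most `M`. -/
def smallSolutionBound (d n M : ℕ) : ℕ := (2 * (eliminationBound d)^[n] M + 2) ^ n

theorem le_eliminationBound (d M : ℕ) : M ≤ eliminationBound d M := by
  unfold eliminationBound
  nlinarith [Nat.zero_le (d * (M + 1) ^ 3), Nat.zero_le (M ^ 2), Nat.zero_le (M ^ 3)]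

theorem le_iterate_eliminationBound (d n M : ℕ) : M ≤ (eliminationBound d)^[n] M := by
  induction n with
  | zero => simp
  | succ n ih =>
    rw [Function.iterate_succ_apply']
    exact ih.trans (le_eliminationBound _ _)

theorem smallSolutionBound_succ (d n M : ℕ) :
    eliminationBound d M * (1 + smallSolutionBound d n (eliminationBound d M)) ≤
      smallSolutionBound d (n + 1) M := by
  unfold smallSolutionBound
  rw [Function.iterate_succ_apply]
  have h := le_iterate_eliminationBound d n (eliminationBound d M)
  set W := (eliminationBound d)^[n] (eliminationBound d M)
  have h1 : 1 ≤ (2 * W + 2) ^ n := Nat.one_le_pow _ _ (by omega)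
  rw [pow_succ]
  nlinarith

theorem abs_dotProduct_le {n : ℕ} {a x : Fin n → ℤ} {M G : ℤ} (hM : 0 ≤ M)
    (ha : ∀ i, |a i| ≤ M) (hx : ∀ i, |x i| ≤ G) : |a ⬝ᵥ x| ≤ n * M * G := by
  calc |a ⬝ᵥ x| ≤ ∑ i, |a i * x i| := Finset.abs_sum_le_sum_abs _ _
    _ ≤ ∑ _i : Fin n, M * G := by
      refine Finset.sum_le_sum fun i _ => ?_
      rw [abs_mul]
      exact mul_le_mul (ha i) (hx i) (abs_nonneg _) hM
    _ = n * M * G := by simp [mul_assoc]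

/-- Moving one coordinate towards zero as long as the system stays satisfied, it reaches zero or
one of the constraints becomes nearly tight. -/
theorem exists_nearly_tight {n : ℕ} (S : Set ((Fin (n + 1) → ℤ) × ℤ)) (x : Fin (n + 1) → ℤ)
    (hx : ∀ p ∈ S, 0 ≤ p.1 ⬝ᵥ x + p.2) :
    ∃ x₀ : ℤ, (∀ p ∈ S, 0 ≤ p.1 ⬝ᵥ (Fin.cons x₀ (Fin.tail x) : Fin (n + 1) → ℤ) + p.2) ∧
      (x₀ = 0 ∨ ∃ p ∈ S, ∃ e : ℤ, |e| = 1 ∧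
        p.1 ⬝ᵥ (Fin.cons x₀ (Fin.tail x) : Fin (n + 1) → ℤ) + p.2 < e * p.1 0) := by
  classical
  have hex : ∃ N : ℕ, ∃ x₀ : ℤ, x₀.natAbs = N ∧
      ∀ p ∈ S, 0 ≤ p.1 ⬝ᵥ (Fin.cons x₀ (Fin.tail x) : Fin (n + 1) → ℤ) + p.2 :=
    ⟨_, x 0, rfl, by simpa [Fin.cons_self_tail] using hx⟩
  obtain ⟨x₀, hN, hsol⟩ := Nat.find_spec hex
  refine ⟨x₀, hsol, ?_⟩
  by_cases h0 : x₀ = 0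
  · exact Or.inl h0
  right
  -- `x₀` has minimal absolute value, so one more unit step towards zero must violate some
  -- constraint; that constraint is the nearly tight one.
  have hlt : (x₀ - x₀.sign).natAbs < Nat.find hex := by
    rw [← hN]
    rcases lt_or_gt_of_ne h0 with h | h
    · rw [Int.sign_eq_neg_one_of_neg h]; omega
    · rw [Int.sign_eq_one_of_pos h]; omega
  have hmin := Nat.find_min hex hlt
  push Not at hmin
  obtain ⟨p, hp, hneg⟩ := hmin _ rfl
  refine ⟨p, hp, x₀.sign, ?_, ?_⟩
  · rcases lt_or_gt_of_ne h0 with h | h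
    · rw [Int.sign_eq_neg_one_of_neg h]; rfl
    · rw [Int.sign_eq_one_of_pos h]; rfl
  · simp only [dotProduct, Fin.sum_univ_succ, Fin.cons_zero, Fin.cons_succ] at hneg ⊢
    linarith

/-- The sizes met in one elimination step: after the trivial bound, the coefficients and the
constant terms of the substituted system, then the constant and the linear part of the recovered
first coordinate. -/
theorem eliminationBound_estimates {d n M : ℕ} (h : n ≤ d) :
    (1 : ℤ) ≤ (eliminationBound d M : ℕ) ∧
    (M : ℤ) * M + M * M ≤ (eliminationBound d M : ℕ) ∧
    (M : ℤ) * (2 * M + n * M * M) + n * M * M + M ≤ (eliminationBound d M : ℕ) ∧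
    2 * (M : ℤ) + n * M * M ≤ (eliminationBound d M : ℕ) ∧
    (n : ℤ) * M ≤ (eliminationBound d M : ℕ) := by
  have h1 : n * M ≤ d * M := by gcongr
  have h2 : n * M * M ≤ d * M * M := by gcongr
  have h3 : n * M * M * M ≤ d * M * M * M := by gcongr
  have hE : eliminationBound d M = 4 * (d * M * M * M) + 12 * (d * M * M) + 12 * (d * M) + 4 * d +
      4 * (M * M * M) + 12 * (M * M) + 12 * M + 4 := by
    unfold eliminationBound; ring
  rw [hE]
  norm_cast
  rw [show M * (2 * M + n * M * M) = 2 * (M * M) + n * M * M * M by ring]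
  refine ⟨?_, ?_, ?_, ?_, ?_⟩ <;> omega

/-- Induction on the number of unknowns: a nearly tight constraint permits an integral substitution
for the first coordinate. The bound ignores the number of constraints, so `S` may even be infinite;
`d` stays fixed so that the same `eliminationBound d` is iterated. -/
theorem exists_small_solution (d : ℕ) : ∀ (n : ℕ), n ≤ d → ∀ (M : ℕ)
    (S : Set ((Fin n → ℤ) × ℤ)), (∀ p ∈ S, (∀ i, |p.1 i| ≤ M) ∧ |p.2| ≤ M) →
    ∀ x : Fin n → ℤ, (∀ p ∈ S, 0 ≤ p.1 ⬝ᵥ x + p.2) →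
    ∃ y : Fin n → ℤ, (∀ i, |y i| ≤ smallSolutionBound d n M) ∧ ∀ p ∈ S, 0 ≤ p.1 ⬝ᵥ y + p.2 := by
  intro n
  induction n with
  | zero => exact fun _ M S _ x hx => ⟨x, fun i => i.elim0, hx⟩
  | succ n ih =>
    intro hn M S hS x hx
    have hF : ((eliminationBound d M : ℕ) : ℤ) *
        (1 + smallSolutionBound d n (eliminationBound d M)) ≤ smallSolutionBound d (n + 1) M :=
      mod_cast smallSolutionBound_succ d n M
    have hMle : (M : ℤ) ≤ (eliminationBound d M : ℕ) := mod_cast le_eliminationBound d M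
    have ih' := ih (by omega) (eliminationBound d M)
    set M' : ℤ := ((eliminationBound d M : ℕ) : ℤ)
    set G : ℤ := (smallSolutionBound d n (eliminationBound d M) : ℤ) with hG
    have hG0 : 0 ≤ G := by positivity
    have hM0 : (0 : ℤ) ≤ M := by positivity
    have hM'0 : 0 ≤ M' := hM0.trans hMle
    obtain ⟨hc0, hc1, hc2, hc3, hc4⟩ := eliminationBound_estimates (n := n) (M := M)
      (show n ≤ d by omega)
    obtain ⟨x₀, hsol, h0 | ⟨⟨a, c⟩, hp, e, he, htight⟩⟩ := exists_nearly_tight S x hx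
    · obtain ⟨y, hy, hyS⟩ := ih' ((fun p => (Fin.tail p.1, p.2)) '' S)
        (by
          rintro _ ⟨p, hp, rfl⟩
          exact ⟨fun i => ((hS p hp).1 _).trans hMle, ((hS p hp).2).trans hMle⟩)
        (Fin.tail x)
        (by
          rintro _ ⟨p, hp, rfl⟩
          have := hsol p hp
          rw [h0] at this
          simpa [dotProduct, Fin.sum_univ_succ, Fin.tail] using this)
      refine ⟨Fin.cons 0 y, ?_, fun p hp => ?_⟩
      · intro i
        refine Fin.cases ?_ (fun i => ?_) i
        · simp
        · rw [Fin.cons_succ]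
          have := hy i
          linarith [le_mul_of_one_le_left (show 0 ≤ 1 + G by omega) hc0]
      · have := hyS _ ⟨p, hp, rfl⟩
        simpa [dotProduct, Fin.sum_univ_succ, Fin.tail] using this
    · obtain ⟨ha, hcM⟩ := hS _ hp
      have hs0 := hsol _ hp
      simp only at ha hcM hs0 htight
      set s := a ⬝ᵥ (Fin.cons x₀ (Fin.tail x) : Fin (n + 1) → ℤ) + c with hs
      set Q := e * a 0 with hQ
      have hQ0 : 0 < Q := hs0.trans_lt htight
      have hee : e * e = 1 := by
        have := abs_mul_abs_self e
        rw [he] at this; linarith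
      have hQM : Q ≤ M := by
        calc Q ≤ |Q| := le_abs_self _
          _ = |a 0| := by rw [hQ, abs_mul, he, one_mul]
          _ ≤ M := ha 0
      set a' : Fin n → ℤ := Fin.tail a
      -- Solving the nearly tight constraint for the first coordinate divides by `Q`. Splitting the
      -- other coordinates as `Q • y₀ + r` keeps the solution integral: it becomes `t - e * (a' ⬝ᵥ
      -- y₀)`, with `t` and `r` bounded, and `y₀` is the new unknown.
      set r : Fin n → ℤ := fun i => Fin.tail x i % Q
      set y₀ : Fin n → ℤ := fun i => Fin.tail x i / Q
      have hxr : Fin.tail x = Q • y₀ + r := by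
        ext i
        simp [r, y₀, Int.mul_ediv_add_emod]
      have hr : ∀ i, |r i| ≤ M := fun i => by
        rw [abs_of_nonneg (Int.emod_nonneg _ hQ0.ne')]
        exact (Int.emod_lt_of_pos _ hQ0).le.trans hQM
      have ha' : ∀ i, |a' i| ≤ M := fun i => ha _
      have hdot : ∀ (p : Fin (n + 1) → ℤ) (z : ℤ) (w : Fin n → ℤ),
          p ⬝ᵥ (Fin.cons z w : Fin (n + 1) → ℤ) = p 0 * z + Fin.tail p ⬝ᵥ w := fun p z w => by
        simp [dotProduct, Fin.sum_univ_succ, Fin.tail]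
      have hsx : s = a 0 * x₀ + (Q * (a' ⬝ᵥ y₀) + a' ⬝ᵥ r) + c := by
        rw [hs, hdot, hxr, dotProduct_add, dotProduct_smul, smul_eq_mul]
      set t := x₀ + e * (a' ⬝ᵥ y₀) with ht
      have hQt : Q * t = e * (s - c - a' ⬝ᵥ r) := by
        rw [hsx, ht, hQ]
        ring
      have har := abs_dotProduct_le hM0 ha' hr
      have htM : |t| ≤ 2 * M + n * M * M := by
        have h1 : |t| ≤ |Q * t| := by
          rw [abs_mul, abs_of_pos hQ0]
          exact le_mul_of_one_le_left (abs_nonneg t) hQ0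
        rw [hQt, abs_mul, he, one_mul] at h1
        have h2 : |s - c - a' ⬝ᵥ r| ≤ |s| + |c| + |a' ⬝ᵥ r| :=
          (abs_sub _ _).trans (by gcongr; exact abs_sub _ _)
        have h3 : |s| ≤ M := by rw [abs_of_nonneg hs0]; omega
        linarith
      obtain ⟨y, hy, hyS⟩ := ih' ((fun p : (Fin (n + 1) → ℤ) × ℤ =>
          ((fun i => Q * Fin.tail p.1 i - p.1 0 * e * a' i),
            p.1 0 * t + Fin.tail p.1 ⬝ᵥ r + p.2)) '' S)
        (by
          rintro _ ⟨p, hp, rfl⟩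
          obtain ⟨h1, h2⟩ := hS p hp
          refine ⟨fun i => ?_, ?_⟩
          · refine le_trans ((abs_sub _ _).trans (add_le_add ?_ ?_)) hc1
            · rw [abs_mul, abs_of_pos hQ0]
              exact mul_le_mul hQM (h1 _) (abs_nonneg _) hM0
            · rw [abs_mul, abs_mul, he, mul_one]
              exact mul_le_mul (h1 _) (ha' _) (abs_nonneg _) hM0
          · refine le_trans ((abs_add_le _ _).trans
              (add_le_add ((abs_add_le _ _).trans (add_le_add ?_ ?_)) h2)) hc2
            · rw [abs_mul]
              exact mul_le_mul (h1 _) htM (abs_nonneg _) hM0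
            · exact abs_dotProduct_le hM0 (fun i => h1 _) hr)
        y₀
        (by
          rintro _ ⟨p, hp, rfl⟩
          have := hsol p hp
          rw [hdot, hxr, dotProduct_add, dotProduct_smul, smul_eq_mul] at this
          have h1 : (fun i => Q * Fin.tail p.1 i - p.1 0 * e * a' i) ⬝ᵥ y₀ =
              Q * (Fin.tail p.1 ⬝ᵥ y₀) - p.1 0 * e * (a' ⬝ᵥ y₀) := by
            simp only [dotProduct, Finset.mul_sum, ← Finset.sum_sub_distrib]
            exact Finset.sum_congr rfl fun i _ => by ring
          simp only [h1]
          rw [ht]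
          linarith)
      refine ⟨Fin.cons (t - e * (a' ⬝ᵥ y)) (Q • y + r), ?_, fun p hp => ?_⟩
      · intro i
        refine le_trans ?_ hF
        refine Fin.cases ?_ (fun i => ?_) i
        · rw [Fin.cons_zero]
          have h1 := abs_dotProduct_le hM0 ha' hy
          have h2 : |t - e * (a' ⬝ᵥ y)| ≤ |t| + |a' ⬝ᵥ y| := by
            refine (abs_sub _ _).trans ?_
            rw [abs_mul, he, one_mul]
          linarith [mul_le_mul_of_nonneg_right hc4 hG0]
        · rw [Fin.cons_succ, Pi.add_apply, Pi.smul_apply, smul_eq_mul]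
          have h1 : |Q * y i| ≤ M * G := by
            rw [abs_mul, abs_of_pos hQ0]
            exact mul_le_mul hQM (hy i) (abs_nonneg _) hM0
          have h2 := abs_add_le (Q * y i) (r i)
          linarith [hr i, mul_le_mul_of_nonneg_right hMle hG0]
      · have := hyS _ ⟨p, hp, rfl⟩
        have h1 : (fun i => Q * Fin.tail p.1 i - p.1 0 * e * a' i) ⬝ᵥ y =
            Q * (Fin.tail p.1 ⬝ᵥ y) - p.1 0 * e * (a' ⬝ᵥ y) := by
          simp only [dotProduct, Finset.mul_sum, ← Finset.sum_sub_distrib]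
          exact Finset.sum_congr rfl fun i _ => by ring
        simp only [h1] at this
        rw [hdot, dotProduct_add, dotProduct_smul, smul_eq_mul]
        linarith

/-! ### Iterated differences and the sign of linear recurrence sequences -/

/-- The sequence obtained from `u` by applying the operators `E - r i` for `i < j`, where `E` is
the shift. -/
def newtonDiff (r : ℕ → ℤ) (u : ℕ → ℤ) : ℕ → ℕ → ℤ
  | 0 => u
  | j + 1 => fun n => newtonDiff r u j (n + 1) - r j * newtonDiff r u j n

/-- The shift operator on integer sequences. -/
def shiftEnd : Module.End ℤ (ℕ → ℤ) := LinearMap.funLeft ℤ ℤ Nat.succ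

@[simp] theorem shiftEnd_apply (u : ℕ → ℤ) (n : ℕ) : shiftEnd u n = u (n + 1) := rfl

open Polynomial in
theorem newtonDiff_eq_aeval (r : ℕ → ℤ) (u : ℕ → ℤ) (j : ℕ) :
    newtonDiff r u j = aeval shiftEnd (∏ i ∈ Finset.range j, (X - C (r i))) u := by
  induction j with
  | zero => simp [newtonDiff]
  | succ j ih =>
    rw [Finset.prod_range_succ, mul_comm, map_mul, Module.End.mul_apply, ← ih]
    ext n
    simp [newtonDiff]

open Polynomial in
theorem aeval_shiftEnd_of_pow {d : ℕ} (T : Matrix (Fin d) (Fin d) ℤ) (w δ : Fin d → ℤ)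
    (q : ℤ[X]) :
    aeval shiftEnd q (fun n => w ⬝ᵥ (T ^ n *ᵥ δ)) = fun n => w ⬝ᵥ (T ^ n *ᵥ (aeval T q *ᵥ δ)) := by
  induction q using Polynomial.induction_on' with
  | add p q hp hq =>
    rw [map_add, LinearMap.add_apply, hp, hq]
    ext n
    simp [Matrix.add_mulVec, Matrix.mulVec_add, dotProduct_add]
  | monomial k a =>
    rw [← C_mul_X_pow_eq_monomial, ← smul_eq_C_mul]
    have : ∀ (k : ℕ) (u : ℕ → ℤ), (shiftEnd ^ k) u = fun n => u (n + k) := by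
      intro k
      induction k with
      | zero => simp
      | succ k ih =>
        intro u
        ext n
        rw [pow_succ, Module.End.mul_apply, ih]
        simp [add_assoc]
    ext n
    rw [map_smul, map_smul, map_pow, map_pow, aeval_X, aeval_X, LinearMap.smul_apply, this,
      Pi.smul_apply, Matrix.smul_mulVec, Matrix.mulVec_smul, dotProduct_smul, pow_add,
      Matrix.mulVec_mulVec]

theorem newtonDiff_neg (r u : ℕ → ℤ) (j n : ℕ) :
    newtonDiff r (fun n => -u n) j n = -newtonDiff r u j n := by
  induction j generalizing n with
  | zero => rfl
  | succ j ih => simp only [newtonDiff, ih]; ring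

/-- Downward induction: a sequence killed by `E - r k` is geometric, hence zero if its initial value
is. -/
theorem newtonDiff_eq_zero_of_lead {r u : ℕ → ℤ} {j m : ℕ} (hjm : j ≤ m)
    (hm : ∀ n, newtonDiff r u m n = 0) (h : ∀ i < m, j ≤ i → newtonDiff r u i 0 = 0) :
    ∀ n, newtonDiff r u j n = 0 := by
  induction hjm using Nat.decreasingInduction with
  | self => exact hm
  | of_succ k hk ih =>
    have ih := ih fun i hi hki => h i hi (by omega)
    intro n
    induction n with
    | zero => exact h k hk le_rfl
    | succ n ihn =>
      have := ih n
      simp only [newtonDiff, ihn, mul_zero, sub_zero] at this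
      exact this

/-- A sequence whose image under `E - a` grows at least like `b ^ n`, where `a ≤ b`, does so
itself. -/
theorem grows_of_sub_grows {a b : ℤ} (ha : 0 ≤ a) (hab : a ≤ b) (hb : 1 ≤ b) {w : ℕ → ℤ}
    (h : ∃ K : ℤ, 0 < K ∧ ∃ N, ∀ n ≥ N, b ^ n ≤ K * (w (n + 1) - a * w n)) :
    ∃ K : ℤ, 0 < K ∧ ∃ N, ∀ n ≥ N, b ^ n ≤ K * w n := by
  obtain ⟨K, hK, N, hN⟩ := h
  have hpos : ∀ n, 0 < b ^ n := fun n => pow_pos (by omega) n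
  have hex : ∃ n ≥ N, 0 ≤ w n := by
    by_contra! hneg
    -- While `w` is negative, `a` may be replaced by `b`; then `w n / b ^ n` gains at least `1 / (K
    -- * b)` per step and cannot stay negative.
    have key : ∀ t : ℕ, t * b ^ (N + t) ≤ K * b * (w (N + t) - b ^ t * w N) := by
      intro t
      induction t with
      | zero => simp
      | succ t ih =>
        have h1 := hN (N + t) (by omega)
        have h2 := hneg (N + t) (by omega)
        have h3 : K * (a * w (N + t)) ≥ K * (b * w (N + t)) :=
          mul_le_mul_of_nonneg_left (by nlinarith) hK.le
        have h4 : b ^ (N + t) ≤ K * w (N + t + 1) - K * (b * w (N + t)) := by linarith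
        rw [← add_assoc, pow_succ b t, pow_succ]
        push_cast
        have h5 := mul_le_mul_of_nonneg_left ih (show 0 ≤ b by omega)
        have h6 := mul_le_mul_of_nonneg_left h4 (show 0 ≤ b by omega)
        linarith
    have h1 := key (K * b * (-w N)).toNat
    set t := (K * b * (-w N)).toNat
    have h2 := hneg (N + t) (by omega)
    have h3 : K * b * (-w N) ≤ t := Int.self_le_toNat _
    have h4 := mul_le_mul_of_nonneg_left h3 (hpos t).le
    have h5 : (t : ℤ) * b ^ t ≤ t * b ^ (N + t) :=
      mul_le_mul_of_nonneg_left (pow_le_pow_right₀ hb (by omega)) (by positivity)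
    have h6 : K * b * w (N + t) < 0 := mul_neg_of_pos_of_neg (by positivity) h2
    nlinarith
  obtain ⟨n₀, hn₀, hw₀⟩ := hex
  have hnonneg : ∀ n ≥ n₀, 0 ≤ w n := by
    intro n hn
    induction n, hn using Nat.le_induction with
    | base => exact hw₀
    | succ n hn ih =>
      have h1 := hN n (by omega)
      have h2 : 0 < w (n + 1) - a * w n := pos_of_mul_pos_right ((hpos n).trans_le h1) hK.le
      have := mul_nonneg ha ih
      linarith
  refine ⟨K * b, by positivity, n₀ + 1, fun n hn => ?_⟩
  obtain ⟨n, rfl⟩ : ∃ k, n = k + 1 := ⟨n - 1, by omega⟩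
  have h1 := hN n (by omega)
  have h2 := mul_nonneg hK.le (mul_nonneg ha (hnonneg n (by omega)))
  have h3 : b ^ n ≤ K * w (n + 1) := by linarith
  rw [pow_succ]
  nlinarith [mul_le_mul_of_nonneg_left h3 (show 0 ≤ b by omega)]

/-- If the last nonvanishing leading difference is positive and belongs to a positive root, the
sequence is eventually positive. -/
theorem eventually_pos_of_lead {r u : ℕ → ℤ} (hr : Monotone r) (h0 : ∀ i, 0 ≤ r i) {j m : ℕ}
    (hjm : j < m) (hm : ∀ n, newtonDiff r u m n = 0) (hj : 1 ≤ r j)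
    (hpos : 0 < newtonDiff r u j 0) (h : ∀ i < m, j < i → newtonDiff r u i 0 = 0) :
    ∃ N, ∀ n ≥ N, 0 < u n := by
  have hz := newtonDiff_eq_zero_of_lead (j := j + 1) hjm hm fun i hi hji => h i hi hji
  have hgeom : ∀ n, newtonDiff r u j n = r j ^ n * newtonDiff r u j 0 := by
    intro n
    induction n with
    | zero => simp
    | succ n ih =>
      have := hz n
      simp only [newtonDiff] at this
      rw [pow_succ, sub_eq_zero.1 this, ih]; ring
  have key : ∀ i ≤ j, ∃ K : ℤ, 0 < K ∧ ∃ N, ∀ n ≥ N, r j ^ n ≤ K * newtonDiff r u i n := by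
    intro i hi
    induction hi using Nat.decreasingInduction with
    | self =>
      refine ⟨1, one_pos, 0, fun n _ => ?_⟩
      rw [hgeom, one_mul]
      exact le_mul_of_one_le_right (pow_nonneg (h0 _) _) hpos
    | of_succ k hk ih => exact grows_of_sub_grows (h0 k) (hr hk.le) hj ih
  obtain ⟨K, hK, N, hN⟩ := key 0 (Nat.zero_le _)
  exact ⟨N, fun n hn => pos_of_mul_pos_right ((pow_pos (by omega) n).trans_le (hN n hn)) hK.le⟩

/-- A positive solution of a linear recurrence with nonnegative roots has a last nonvanishing
leading difference belonging to a positive root, and that difference is positive. -/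
theorem exists_lead_of_pos {r u : ℕ → ℤ} (hr : Monotone r) (h0 : ∀ i, 0 ≤ r i) {z m : ℕ}
    (hzm : z ≤ m) (hrz : ∀ i < z, r i = 0) (hz : ∀ i, z ≤ i → 1 ≤ r i)
    (hm : ∀ n, newtonDiff r u m n = 0) (hu : ∀ n, 0 < u n) :
    ∃ j < m, z ≤ j ∧ 0 < newtonDiff r u j 0 ∧ ∀ i < m, j < i → newtonDiff r u i 0 = 0 := by
  classical
  have hex : ∃ j < m, z ≤ j ∧ newtonDiff r u j 0 ≠ 0 := by
    by_contra! hcon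
    have h1 := newtonDiff_eq_zero_of_lead hzm hm hcon
    have h2 : ∀ i ≤ z, ∀ n, newtonDiff r u i n = u (n + i) := by
      intro i
      induction i with
      | zero => exact fun _ _ => rfl
      | succ i ih =>
        intro hi n
        simp only [newtonDiff, hrz i (by omega), ih (by omega)]
        rw [zero_mul, sub_zero, add_right_comm, add_assoc]
    have := hu (0 + z)
    rw [← h2 z le_rfl, h1] at this
    exact lt_irrefl _ this
  obtain ⟨j₀, hj₀, hP₀⟩ := hex
  let P : ℕ → Prop := fun j => j < m ∧ z ≤ j ∧ newtonDiff r u j 0 ≠ 0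
  have hP : P (Nat.findGreatest P m) := Nat.findGreatest_spec hj₀.le ⟨hj₀, hP₀⟩
  set j := Nat.findGreatest P m
  have hgt : ∀ i < m, j < i → newtonDiff r u i 0 = 0 := by
    intro i hi hji
    by_contra hne
    exact Nat.findGreatest_is_greatest hji hi.le ⟨hi, hP.2.1.trans hji.le, hne⟩
  refine ⟨j, hP.1, hP.2.1, ?_, hgt⟩
  by_contra hle
  have hlt : newtonDiff r u j 0 < 0 := lt_of_le_of_ne (not_lt.1 hle) hP.2.2
  obtain ⟨N, hN⟩ := eventually_pos_of_lead (u := fun n => -u n) hr h0 hP.1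
    (fun n => by rw [newtonDiff_neg, hm, neg_zero]) (hz j hP.2.1)
    (by rw [newtonDiff_neg]; omega) (fun i hi hji => by rw [newtonDiff_neg, hgt i hi hji, neg_zero])
  have h1 := hN N le_rfl
  have h2 := hu N
  omega

/-! ### Primitive recursive functions on the integers -/

section PrimrecInt

variable {α : Type*} [Primcodable α]

theorem List.getD_map_range {β : Type*} (f : ℕ → β) {n m : ℕ} (h : n < m) (b : β) :
    ((List.range m).map f).getD n b = f n := by
  simp [List.getD_eq_getElem?_getD, h]

/-- The parity of the code is the sign, so positive and negative parts can be read off; integer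
arithmetic then reduces to these natural numbers. -/
theorem Int.encode_eq (z : ℤ) :
    Encodable.encode z = if 0 ≤ z then 2 * z.toNat else 2 * ((-z).toNat - 1) + 1 := by
  rcases z with n | n
  · rfl
  · rw [if_neg (by omega)]
    change 2 * n + 1 = _
    omega

theorem Primrec.int_toNat : Primrec Int.toNat := by
  have h : Primrec fun z : ℤ => if Encodable.encode z % 2 = 0 then Encodable.encode z / 2 else 0 :=
    Primrec.ite (Primrec.eq.comp (Primrec.nat_mod.comp Primrec.encode (.const 2)) (.const 0))
      (Primrec.nat_div.comp Primrec.encode (.const 2)) (.const 0)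
  refine h.of_eq fun z => ?_
  rw [Int.encode_eq]
  split_ifs <;> omega

theorem Primrec.int_neg_toNat : Primrec fun z : ℤ => (-z).toNat := by
  have h : Primrec fun z : ℤ =>
      if Encodable.encode z % 2 = 0 then 0 else Encodable.encode z / 2 + 1 :=
    Primrec.ite (Primrec.eq.comp (Primrec.nat_mod.comp Primrec.encode (.const 2)) (.const 0))
      (.const 0) (Primrec.succ.comp (Primrec.nat_div.comp Primrec.encode (.const 2)))
  refine h.of_eq fun z => ?_
  rw [Int.encode_eq]
  split_ifs <;> omega

theorem Primrec.int_subNat : Primrec₂ fun a b : ℕ => (a : ℤ) - b := by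
  refine Primrec₂.encode_iff.1 ?_
  have h : Primrec fun p : ℕ × ℕ =>
      if p.2 ≤ p.1 then 2 * (p.1 - p.2) else 2 * ((p.2 - p.1) - 1) + 1 :=
    Primrec.ite (Primrec.nat_le.comp .snd .fst)
      (Primrec.nat_double.comp (Primrec.nat_sub.comp .fst .snd))
      (Primrec.nat_double_succ.comp
        (Primrec.nat_sub.comp (Primrec.nat_sub.comp .snd .fst) (.const 1)))
  refine h.of_eq fun ⟨a, b⟩ => ?_
  simp only
  rw [Int.encode_eq]
  split_ifs <;> omega

theorem Primrec.int_natCast {f : α → ℕ} (hf : Primrec f) : Primrec fun a => (f a : ℤ) :=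
  (Primrec.int_subNat.comp hf (.const 0)).of_eq fun a => by simp

theorem Primrec.int_add {f g : α → ℤ} (hf : Primrec f) (hg : Primrec g) :
    Primrec fun a => f a + g a :=
  (Primrec.int_subNat.comp
    (Primrec.nat_add.comp (Primrec.int_toNat.comp hf) (Primrec.int_toNat.comp hg))
    (Primrec.nat_add.comp (Primrec.int_neg_toNat.comp hf) (Primrec.int_neg_toNat.comp hg))).of_eq
    fun a => by omega

theorem Primrec.int_sub {f g : α → ℤ} (hf : Primrec f) (hg : Primrec g) :
    Primrec fun a => f a - g a :=
  (Primrec.int_subNat.comp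
    (Primrec.nat_add.comp (Primrec.int_toNat.comp hf) (Primrec.int_neg_toNat.comp hg))
    (Primrec.nat_add.comp (Primrec.int_neg_toNat.comp hf) (Primrec.int_toNat.comp hg))).of_eq
    fun a => by omega

theorem Primrec.int_mul {f g : α → ℤ} (hf : Primrec f) (hg : Primrec g) :
    Primrec fun a => f a * g a := by
  have hp := Primrec.int_toNat.comp hf
  have hn := Primrec.int_neg_toNat.comp hf
  have hp' := Primrec.int_toNat.comp hg
  have hn' := Primrec.int_neg_toNat.comp hg
  refine (Primrec.int_subNat.comp
    (Primrec.nat_add.comp (Primrec.nat_mul.comp hp hp') (Primrec.nat_mul.comp hn hn'))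
    (Primrec.nat_add.comp (Primrec.nat_mul.comp hp hn') (Primrec.nat_mul.comp hn hp'))).of_eq
    fun a => ?_
  have h1 := Int.toNat_sub_toNat_neg (f a)
  have h2 := Int.toNat_sub_toNat_neg (g a)
  conv_rhs => rw [← h1, ← h2]
  push_cast
  ring

theorem Primrec.int_abs {f : α → ℤ} (hf : Primrec f) : Primrec fun a => |f a| :=
  (Primrec.int_natCast (Primrec.nat_add.comp (Primrec.int_toNat.comp hf)
    (Primrec.int_neg_toNat.comp hf))).of_eq fun a => by
      rcases abs_cases (f a) with h | h <;> omega

theorem Primrec.int_pos {f : α → ℤ} (hf : Primrec f) : PrimrecPred fun a => 0 < f a :=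
  (Primrec.nat_lt.comp (.const 0) (Primrec.int_toNat.comp hf)).of_eq fun a => by omega

theorem Primrec.sum_range {n : α → ℕ} {f : α → ℕ → ℤ} (hn : Primrec n) (hf : Primrec₂ f) :
    Primrec fun a => ∑ i ∈ Finset.range (n a), f a i := by
  refine (Primrec.nat_rec' (f := n) (g := fun _ => (0 : ℤ)) (h := fun a p => p.2 + f a p.1) hn
    (.const 0) (Primrec.int_add (Primrec.snd.comp .snd)
      (hf.comp .fst (Primrec.fst.comp .snd)))).of_eq fun a => ?_
  induction n a with
  | zero => rfl
  | succ k ih => simp only [Finset.sum_range_succ, ← ih]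

theorem Primrec.prod_range {n : α → ℕ} {f : α → ℕ → ℕ} (hn : Primrec n) (hf : Primrec₂ f) :
    Primrec fun a => ∏ i ∈ Finset.range (n a), f a i := by
  refine (Primrec.nat_rec' (f := n) (g := fun _ => 1) (h := fun a p => p.2 * f a p.1) hn
    (.const 1) (Primrec.nat_mul.comp (Primrec.snd.comp .snd)
      (hf.comp .fst (Primrec.fst.comp .snd)))).of_eq fun a => ?_
  induction n a with
  | zero => rfl
  | succ k ih => simp only [Finset.prod_range_succ, ← ih]

theorem Primrec.nat_pow {f g : α → ℕ} (hf : Primrec f) (hg : Primrec g) :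
    Primrec fun a => f a ^ g a :=
  (Primrec.prod_range (f := fun a _ => f a) hg (hf.comp .fst)).of_eq fun a => by simp

theorem Primrec.map_range {β : Type*} [Primcodable β] {n : α → ℕ} {f : α → ℕ → β}
    (hn : Primrec n) (hf : Primrec₂ f) : Primrec fun a => (List.range (n a)).map (f a) :=
  Primrec.list_map (Primrec.list_range.comp hn) hf

theorem PrimrecPred.forall_lt_of {n : α → ℕ} {R : α → ℕ → Prop} (hn : Primrec n)
    (hR : PrimrecRel R) : PrimrecPred fun a => ∀ i < n a, R a i :=
  ((PrimrecRel.forall_mem_list (R := fun i a => R a i) hR.swap).comp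
    (Primrec.list_range.comp hn) .id).of_eq fun a => by simp

theorem PrimrecPred.exists_lt_of {n : α → ℕ} {R : α → ℕ → Prop} (hn : Primrec n)
    (hR : PrimrecRel R) : PrimrecPred fun a => ∃ i < n a, R a i :=
  ((PrimrecRel.exists_mem_list (R := fun i a => R a i) hR.swap).comp
    (Primrec.list_range.comp hn) .id).of_eq fun a => by simp

/-- The difference table is computed row by row from the first `j + 1` values. Default values spoil
the right end of a row, but entry `n` of row `t` is correct while `n + t ≤ j`. -/
theorem Primrec.newtonDiff_zero {r u : α → ℕ → ℤ} {j : α → ℕ} (hr : Primrec₂ r)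
    (hu : Primrec₂ u) (hj : Primrec j) : Primrec fun a => newtonDiff (r a) (u a) (j a) 0 := by
  have hl : Primrec fun a => Nat.rec (motive := fun _ => List ℤ) ((List.range (j a + 1)).map (u a))
      (fun t l => (List.range (j a + 1)).map fun n => l.getD (n + 1) 0 - r a t * l.getD n 0)
      (j a) := by
    refine Primrec.nat_rec' (h := fun a p => (List.range (j a + 1)).map fun n =>
      p.2.getD (n + 1) 0 - r a p.1 * p.2.getD n 0) hj
      (Primrec.map_range (Primrec.succ.comp hj) hu)
      (Primrec.map_range (Primrec.succ.comp (hj.comp .fst)) ?_)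
    have hl : Primrec fun q : (α × ℕ × List ℤ) × ℕ => q.1.2.2 :=
      Primrec.snd.comp (Primrec.snd.comp .fst)
    exact Primrec.int_sub ((Primrec.list_getD 0).comp hl (Primrec.succ.comp .snd))
      (Primrec.int_mul (hr.comp (Primrec.fst.comp .fst)
        (Primrec.fst.comp (Primrec.snd.comp .fst))) ((Primrec.list_getD 0).comp hl .snd))
  refine ((Primrec.list_getD 0).comp hl (.const 0)).of_eq fun a => ?_
  have key : ∀ t n, n + t ≤ j a → (Nat.rec (motive := fun _ => List ℤ)
      ((List.range (j a + 1)).map (u a))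
      (fun t l => (List.range (j a + 1)).map fun n => l.getD (n + 1) 0 - r a t * l.getD n 0)
      t).getD n 0 = newtonDiff (r a) (u a) t n := by
    intro t
    induction t with
    | zero =>
      intro n hn
      exact List.getD_map_range _ (by omega) 0
    | succ t ih =>
      intro n hn
      refine (List.getD_map_range _ (by omega) 0).trans ?_
      rw [ih (n + 1) (by omega), ih n (by omega)]
      rfl
  exact key (j a) 0 (by omega)

end PrimrecInt

/-! ### The decision procedure -/

namespace LoopCode

/-- The entry `A i j` of the update matrix. -/
def matA (c : LoopCode) (i j : ℕ) : ℤ := (c.2.2.1.getD i []).getD j 0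

/-- The entry `a i` of the update vector. -/
def vecA (c : LoopCode) (i : ℕ) : ℤ := c.2.2.2.1.getD i 0

/-- The entry `B i j` of the guard matrix, as a numerator and a denominator. -/
def matB (c : LoopCode) (i j : ℕ) : ℤ × ℕ := (c.2.2.2.2.1.getD i []).getD j (0, 1)

/-- The entry `b i` of the guard vector, as a numerator and a denominator. -/
def vecB (c : LoopCode) (i : ℕ) : ℤ × ℕ := c.2.2.2.2.2.getD i (0, 1)

/-- A common denominator of the `i`-th row of the guard. -/
def den (c : LoopCode) (i : ℕ) : ℕ := (∏ j ∈ Finset.range c.1, (c.matB i j).2) * (c.vecB i).2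

/-- The left-hand side of the `i`-th guard at `x`, multiplied by the common denominator. -/
def guardVal (c : LoopCode) (i : ℕ) (x : List ℤ) : ℤ :=
  ∑ j ∈ Finset.range c.1, (c.matB i j).1 * (c.den i / (c.matB i j).2 : ℕ) * x.getD j 0 +
    (c.vecB i).1 * (c.den i / (c.vecB i).2 : ℕ)

/-- The update of the loop. -/
def step (c : LoopCode) (x : List ℤ) : List ℤ :=
  (List.range c.1).map fun i => ∑ j ∈ Finset.range c.1, c.matA i j * x.getD j 0 + c.vecA i

/-- The values of the `i`-th guard after `2 * n + p` steps from `x`. -/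
def obs (c : LoopCode) (i p : ℕ) (x : List ℤ) (n : ℕ) : ℤ :=
  c.guardVal i (c.step^[2 * n + p] x)

/-- A nondecreasing sequence of nonnegative integers in which each occurs `c.1 + 1` times. -/
def root (c : LoopCode) (j : ℕ) : ℤ := (j / (c.1 + 1) : ℕ)

/-- The length of the part of `root c` that contains `1` and the squares of the diagonal entries of
the update matrix, each `c.1 + 1` times. -/
def numRoots (c : LoopCode) : ℕ :=
  ((∑ i ∈ Finset.range c.1, c.matA i i * c.matA i i).toNat + 2) * (c.1 + 1)

/-- The `j`-th leading difference of the sequence `obs c i p x`. -/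
def lead (c : LoopCode) (i p j : ℕ) (x : List ℤ) : ℤ :=
  newtonDiff c.root (c.obs i p x) j 0

/-- The loop runs forever after some number of steps from `x`. -/
def EventuallyRuns (c : LoopCode) (x : List ℤ) : Prop :=
  ∀ i < c.2.1, ∀ p < 2, ∃ j < c.numRoots, c.1 + 1 ≤ j ∧ 0 < c.lead i p j x ∧
    ∀ j' < c.numRoots, j < j' → c.lead i p j' x = 0

/-- The `s`-th unit vector of length `c.1`, and the zero vector for `s ≥ c.1`. -/
def unitVec (c : LoopCode) (s : ℕ) : List ℤ :=
  (List.range c.1).map fun t => if t = s then 1 else 0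

/-- A bound for the coefficients of the affine functions `lead c i p j`. -/
def coeffBound (c : LoopCode) : ℕ :=
  (∑ i ∈ Finset.range c.2.1, ∑ p ∈ Finset.range 2, ∑ j ∈ Finset.range c.numRoots,
    (|c.lead i p j (c.unitVec c.1)| +
      ∑ s ∈ Finset.range c.1, |c.lead i p j (c.unitVec s)|)).toNat + 1

/-- A bound for the entries of some starting point of a nonterminating run. -/
def searchBound (c : LoopCode) : ℕ := smallSolutionBound c.1 c.1 c.coeffBound

/-- The vector with the digits of `e` to the base `2 * H + 1`, shifted to `[-H, H]`. -/
def digitVec (c : LoopCode) (H e : ℕ) : List ℤ :=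
  (List.range c.1).map fun s => ((e / (2 * H + 1) ^ s % (2 * H + 1) : ℕ) : ℤ) - H

/-- A bounded search finds a starting point of a nonterminating run. -/
def SearchSucceeds (c : LoopCode) : Prop :=
  ∃ e < (2 * c.searchBound + 1) ^ c.1, c.EventuallyRuns (c.digitVec c.searchBound e)

/-! ### Primitive recursiveness of the search -/

variable {α : Type*} [Primcodable α] {c : α → LoopCode} {i j p : α → ℕ} {x : α → List ℤ}

theorem primrec_dim (hc : Primrec c) : Primrec fun a => (c a).1 := Primrec.fst.comp hc

theorem primrec_matA (hc : Primrec c) (hi : Primrec i) (hj : Primrec j) :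
    Primrec fun a => (c a).matA (i a) (j a) :=
  (Primrec.list_getD 0).comp ((Primrec.list_getD []).comp
    (Primrec.fst.comp (Primrec.snd.comp (Primrec.snd.comp hc))) hi) hj

theorem primrec_vecA (hc : Primrec c) (hi : Primrec i) : Primrec fun a => (c a).vecA (i a) :=
  (Primrec.list_getD 0).comp
    (Primrec.fst.comp (Primrec.snd.comp (Primrec.snd.comp (Primrec.snd.comp hc)))) hi

theorem primrec_matB (hc : Primrec c) (hi : Primrec i) (hj : Primrec j) :
    Primrec fun a => (c a).matB (i a) (j a) :=
  (Primrec.list_getD (0, 1)).comp ((Primrec.list_getD []).comp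
    (Primrec.fst.comp (Primrec.snd.comp (Primrec.snd.comp (Primrec.snd.comp
      (Primrec.snd.comp hc))))) hi) hj

theorem primrec_vecB (hc : Primrec c) (hi : Primrec i) : Primrec fun a => (c a).vecB (i a) :=
  (Primrec.list_getD (0, 1)).comp
    (Primrec.snd.comp (Primrec.snd.comp (Primrec.snd.comp (Primrec.snd.comp
      (Primrec.snd.comp hc))))) hi

theorem primrec_den (hc : Primrec c) (hi : Primrec i) : Primrec fun a => (c a).den (i a) :=
  Primrec.nat_mul.comp
    (Primrec.prod_range (primrec_dim hc)
      (Primrec.snd.comp (primrec_matB (hc.comp .fst) (hi.comp .fst) .snd)))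
    (Primrec.snd.comp (primrec_vecB hc hi))

theorem primrec_guardVal (hc : Primrec c) (hi : Primrec i) (hx : Primrec x) :
    Primrec fun a => (c a).guardVal (i a) (x a) := by
  have hB := primrec_matB (hc.comp (Primrec.fst (β := ℕ))) (hi.comp .fst) .snd
  have hb := primrec_vecB hc hi
  refine Primrec.int_add (Primrec.sum_range (primrec_dim hc) ?_) ?_
  · exact Primrec.int_mul (Primrec.int_mul (Primrec.fst.comp hB) (Primrec.int_natCast
      (Primrec.nat_div.comp (primrec_den (hc.comp .fst) (hi.comp .fst)) (Primrec.snd.comp hB))))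
      ((Primrec.list_getD 0).comp (hx.comp .fst) .snd)
  · exact Primrec.int_mul (Primrec.fst.comp hb) (Primrec.int_natCast
      (Primrec.nat_div.comp (primrec_den hc hi) (Primrec.snd.comp hb)))

theorem primrec_step (hc : Primrec c) (hx : Primrec x) : Primrec fun a => (c a).step (x a) := by
  refine Primrec.map_range (primrec_dim hc) (Primrec.int_add (Primrec.sum_range
    (primrec_dim (hc.comp .fst)) (Primrec.int_mul (primrec_matA (hc.comp (Primrec.fst.comp .fst))
      (Primrec.snd.comp .fst) .snd) ?_)) (primrec_vecA (hc.comp .fst) .snd))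
  exact (Primrec.list_getD 0).comp (hx.comp (Primrec.fst.comp .fst)) .snd

theorem primrec_obs {n : α → ℕ} (hc : Primrec c) (hi : Primrec i) (hp : Primrec p)
    (hx : Primrec x) (hn : Primrec n) :
    Primrec fun a => (c a).obs (i a) (p a) (x a) (n a) :=
  primrec_guardVal hc hi (Primrec.nat_iterate
    (Primrec.nat_add.comp (Primrec.nat_double.comp hn) hp) hx
    (primrec_step (hc.comp .fst) .snd))

theorem primrec_root (hc : Primrec c) (hj : Primrec j) : Primrec fun a => (c a).root (j a) :=
  Primrec.int_natCast (Primrec.nat_div.comp hj (Primrec.succ.comp (primrec_dim hc)))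

theorem primrec_numRoots (hc : Primrec c) : Primrec fun a => (c a).numRoots := by
  have h := primrec_matA (hc.comp (Primrec.fst (β := ℕ))) .snd .snd
  exact Primrec.nat_mul.comp (Primrec.nat_add.comp (Primrec.int_toNat.comp
    (Primrec.sum_range (primrec_dim hc) (Primrec.int_mul h h))) (.const 2))
    (Primrec.succ.comp (primrec_dim hc))

theorem primrec_lead (hc : Primrec c) (hi : Primrec i) (hp : Primrec p) (hj : Primrec j)
    (hx : Primrec x) : Primrec fun a => (c a).lead (i a) (p a) (j a) (x a) :=
  Primrec.newtonDiff_zero (primrec_root (hc.comp .fst) .snd)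
    (primrec_obs (hc.comp .fst) (hi.comp .fst) (hp.comp .fst) (hx.comp .fst) .snd) hj

theorem primrecPred_eventuallyRuns (hc : Primrec c) (hx : Primrec x) :
    PrimrecPred fun a => (c a).EventuallyRuns (x a) := by
  refine PrimrecPred.forall_lt_of (Primrec.fst.comp (Primrec.snd.comp hc))
    (PrimrecPred.forall_lt_of (.const 2)
      (PrimrecPred.exists_lt_of (primrec_numRoots (hc.comp (Primrec.fst.comp .fst)))
        (PrimrecPred.and (Primrec.nat_le.comp (Primrec.succ.comp (primrec_dim
          (hc.comp (Primrec.fst.comp (Primrec.fst.comp .fst))))) .snd)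
        (PrimrecPred.and (Primrec.int_pos (primrec_lead
          (hc.comp (Primrec.fst.comp (Primrec.fst.comp .fst)))
          (Primrec.snd.comp (Primrec.fst.comp .fst)) (Primrec.snd.comp .fst) .snd
          (hx.comp (Primrec.fst.comp (Primrec.fst.comp .fst)))))
        (PrimrecPred.forall_lt_of (primrec_numRoots
          (hc.comp (Primrec.fst.comp (Primrec.fst.comp .fst)))) ?_)))))
  refine ((Primrec.nat_lt.comp (Primrec.snd.comp .fst) .snd).not.or
    (Primrec.eq.comp (primrec_lead
      (hc.comp (Primrec.fst.comp (Primrec.fst.comp (Primrec.fst.comp .fst))))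
      (Primrec.snd.comp (Primrec.fst.comp (Primrec.fst.comp .fst)))
      (Primrec.snd.comp (Primrec.fst.comp .fst)) .snd
      (hx.comp (Primrec.fst.comp (Primrec.fst.comp (Primrec.fst.comp .fst))))) (.const 0))).of_eq ?_
  exact fun a => imp_iff_not_or.symm

theorem primrec_unitVec {s : α → ℕ} (hc : Primrec c) (hs : Primrec s) :
    Primrec fun a => (c a).unitVec (s a) :=
  Primrec.map_range (primrec_dim hc)
    (Primrec.ite (Primrec.eq.comp .snd (hs.comp .fst)) (.const 1) (.const 0))

theorem primrec_coeffBound (hc : Primrec c) : Primrec fun a => (c a).coeffBound := by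
  refine Primrec.succ.comp (Primrec.int_toNat.comp (Primrec.sum_range
    (Primrec.fst.comp (Primrec.snd.comp hc)) (Primrec.sum_range (.const 2) (Primrec.sum_range
      (primrec_numRoots (hc.comp (Primrec.fst.comp .fst))) (Primrec.int_add ?_
        (Primrec.sum_range
          (primrec_dim (hc.comp (Primrec.fst.comp (Primrec.fst.comp .fst)))) ?_))))))
  · have hc' := hc.comp (Primrec.fst.comp (Primrec.fst.comp (Primrec.fst (α := (α × ℕ) × ℕ) (β := ℕ))))
    exact Primrec.int_abs (primrec_lead hc' (Primrec.snd.comp (Primrec.fst.comp .fst))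
      (Primrec.snd.comp .fst) .snd (primrec_unitVec hc' (primrec_dim hc')))
  · have hc' := hc.comp (Primrec.fst.comp (Primrec.fst.comp (Primrec.fst.comp
      (Primrec.fst (α := ((α × ℕ) × ℕ) × ℕ) (β := ℕ)))))
    exact Primrec.int_abs (primrec_lead hc'
      (Primrec.snd.comp (Primrec.fst.comp (Primrec.fst.comp .fst)))
      (Primrec.snd.comp (Primrec.fst.comp .fst)) (Primrec.snd.comp .fst)
      (primrec_unitVec hc' .snd))

theorem primrec_searchBound (hc : Primrec c) : Primrec fun a => (c a).searchBound := by
  have hd := primrec_dim hc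
  refine Primrec.nat_pow (Primrec.succ.comp (Primrec.succ.comp (Primrec.nat_double.comp
    (Primrec.nat_iterate hd (primrec_coeffBound hc)
      (h := fun a M => eliminationBound (c a).1 M) ?_)))) hd
  exact Primrec.nat_mul.comp (Primrec.nat_mul.comp (.const 4) (Primrec.succ.comp (hd.comp .fst)))
    (Primrec.nat_pow (Primrec.succ.comp .snd) (.const 3))

theorem primrec_digitVec {H e : α → ℕ} (hc : Primrec c) (hH : Primrec H) (he : Primrec e) :
    Primrec fun a => (c a).digitVec (H a) (e a) := by
  have hS : Primrec fun q : α × ℕ => 2 * H q.1 + 1 := Primrec.nat_double_succ.comp (hH.comp .fst)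
  exact Primrec.map_range (primrec_dim hc) (Primrec.int_sub (Primrec.int_natCast
    (Primrec.nat_mod.comp (Primrec.nat_div.comp (he.comp .fst) (Primrec.nat_pow hS .snd)) hS))
    (Primrec.int_natCast (hH.comp .fst)))

theorem primrecPred_searchSucceeds : PrimrecPred SearchSucceeds := by
  have hH := primrec_searchBound (Primrec.id (α := LoopCode))
  exact PrimrecPred.exists_lt_of
    (Primrec.nat_pow (Primrec.nat_double_succ.comp hH) (primrec_dim .id))
    (primrecPred_eventuallyRuns .fst (primrec_digitVec .fst (hH.comp .fst) .snd))

end LoopCode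

/-! ### Correctness -/

theorem List.getD_ofFn_fin {β : Type*} {n : ℕ} (f : Fin n → β) (i : Fin n) (b : β) :
    (List.ofFn f).getD i b = f i := by
  simp [List.getD_eq_getElem?_getD]

theorem List.map_range_eq_ofFn {β : Type*} {n : ℕ} (f : ℕ → β) :
    (List.range n).map f = List.ofFn fun i : Fin n => f i := by
  rw [List.ofFn_eq_map, ← List.map_coe_finRange_eq_range, List.map_map]
  rfl

open Polynomial in
/-- A product of `X - a`, over a sequence that contains `1` and the squares of the diagonal
entries of `A` often enough. -/
theorem sub_one_mul_prod_diag_dvd {d N : ℕ} (s : Fin d → ℤ) (h0 : ∀ i, 0 ≤ s i)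
    (hN : ∀ i, s i < N) (h1 : 1 < N) :
    (X - C 1) * ∏ i, (X - C (s i)) ∣
      ∏ j ∈ Finset.range (N * (d + 1)), (X - C (((j / (d + 1) : ℕ) : ℤ)) : ℤ[X]) := by
  have hprod : ∀ N, ∏ j ∈ Finset.range (N * (d + 1)), (X - C (((j / (d + 1) : ℕ) : ℤ)) : ℤ[X]) =
      (∏ v ∈ Finset.range N, (X - C ((v : ℕ) : ℤ))) ^ (d + 1) := by
    intro N
    induction N with
    | zero => simp
    | succ N ih =>
      rw [add_mul, one_mul, Finset.prod_range_add, ih,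
        Finset.prod_range_succ _ N, mul_pow]
      congr 1
      have : ∀ x ∈ Finset.range (d + 1), (X - C ((((N * (d + 1) + x) / (d + 1) : ℕ) : ℤ)) : ℤ[X]) =
          X - C (N : ℤ) := by
        intro x hx
        rw [mul_comm, Nat.mul_add_div (by omega), Nat.div_eq_of_lt (Finset.mem_range.1 hx),
          add_zero]
      rw [Finset.prod_congr rfl this, Finset.prod_const, Finset.card_range]
  have hmem : ∀ z : ℤ, 0 ≤ z → z < N →
      (X - C z : ℤ[X]) ∣ ∏ v ∈ Finset.range N, (X - C ((v : ℕ) : ℤ)) := by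
    intro z hz hzN
    have := Finset.dvd_prod_of_mem (fun v : ℕ => (X - C (v : ℤ) : ℤ[X]))
      (Finset.mem_range.2 (show z.toNat < N by omega))
    simpa only [Int.toNat_of_nonneg hz] using this
  -- Of the `d + 1` copies, one absorbs `X - 1` and each of the others one diagonal factor.
  rw [hprod, pow_succ']
  refine mul_dvd_mul (hmem 1 zero_le_one (by omega)) ?_
  have := Finset.prod_dvd_prod_of_dvd (s := Finset.univ) (fun i => (X - C (s i) : ℤ[X]))
    (fun _ => ∏ v ∈ Finset.range N, (X - C ((v : ℕ) : ℤ))) fun i _ => hmem _ (h0 i) (hN i)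
  simpa using this

namespace AffineLoop

variable (L : AffineLoop)

open Polynomial in
theorem charpoly_eq_prod_diag (hL : L.IsTriangular) :
    L.A.charpoly = ∏ i, (X - C (L.A i i)) := by
  rcases hL with h | h
  · rw [← Matrix.charpoly_transpose, Matrix.charpoly_of_isUpperTriangular]
    · rfl
    · intro i j hij
      exact h j i hij
  · exact Matrix.charpoly_of_isUpperTriangular _ fun i j hij => h i j hij

open Polynomial in
-- Cayley–Hamilton, since `X ^ 2 - a ^ 2` is a multiple of `X - a`.
theorem aeval_sq_prod_diag (hL : L.IsTriangular) :
    aeval (L.A ^ 2) (∏ i, (X - C (L.A i i * L.A i i))) = 0 := by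
  rw [← expand_aeval, map_prod]
  have : L.A.charpoly ∣ ∏ i, expand ℤ 2 (X - C (L.A i i * L.A i i)) := by
    rw [L.charpoly_eq_prod_diag hL]
    refine Finset.prod_dvd_prod_of_dvd _ _ fun i _ => ⟨X + C (L.A i i), ?_⟩
    simp only [map_sub, expand_X, expand_C]
    rw [C_mul]
    ring
  obtain ⟨q, hq⟩ := this
  rw [hq, map_mul, Matrix.aeval_self_charpoly, zero_mul]

/-! ### Faithfulness of the encoding -/

theorem map_range_dim {β : Type*} (f : ℕ → β) :
    (List.range L.code.1).map f = List.ofFn fun i : Fin L.d => f i :=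
  List.map_range_eq_ofFn f

theorem matA_code (i j : Fin L.d) : L.code.matA i j = L.A i j := by
  simp only [LoopCode.matA, code, List.getD_ofFn_fin]

theorem vecA_code (i : Fin L.d) : L.code.vecA i = L.a i := by
  simp only [LoopCode.vecA, code, List.getD_ofFn_fin]

theorem matB_code (i : Fin L.k) (j : Fin L.d) :
    L.code.matB i j = ((L.B i j).num, (L.B i j).den) := by
  simp only [LoopCode.matB, code, List.getD_ofFn_fin]

theorem vecB_code (i : Fin L.k) : L.code.vecB i = ((L.b i).num, (L.b i).den) := by
  simp only [LoopCode.vecB, code, List.getD_ofFn_fin]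

theorem step_code (y : Fin L.d → ℤ) :
    L.code.step (List.ofFn y) = List.ofFn (L.update y) := by
  rw [LoopCode.step, map_range_dim]
  congr 1
  ext i
  rw [vecA_code, Finset.sum_range]
  simp only [update, Pi.add_apply, Matrix.mulVec, dotProduct]
  congr 1
  exact Finset.sum_congr rfl fun j _ =>
    congrArg₂ (· * ·) (L.matA_code i j) (List.getD_ofFn_fin y j 0)

theorem step_iterate_code (y : Fin L.d → ℤ) (n : ℕ) :
    L.code.step^[n] (List.ofFn y) = List.ofFn (L.update^[n] y) := by
  induction n generalizing y with
  | zero => rfl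
  | succ n ih => rw [Function.iterate_succ_apply, step_code, ih, Function.iterate_succ_apply]

theorem den_code_pos (i : Fin L.k) : 0 < L.code.den i := by
  rw [LoopCode.den]
  refine Nat.mul_pos (Finset.prod_pos fun j hj => ?_) ?_
  · have hj : j < L.d := Finset.mem_range.1 hj
    have := L.matB_code i ⟨j, hj⟩
    simp only at this
    rw [this]
    exact Rat.den_pos _
  · rw [vecB_code]
    exact Rat.den_pos _

/-- The coefficients of the `i`-th guard after clearing denominators. -/
def intGuard (i : Fin L.k) (j : Fin L.d) : ℤ :=
  (L.B i j).num * (L.code.den i / (L.B i j).den : ℕ)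

theorem guardVal_code (i : Fin L.k) (y : Fin L.d → ℤ) :
    L.code.guardVal i (List.ofFn y) =
      L.intGuard i ⬝ᵥ y + (L.b i).num * (L.code.den i / (L.b i).den : ℕ) := by
  rw [LoopCode.guardVal, vecB_code, Finset.sum_range]
  congr 1
  refine Finset.sum_congr rfl fun j _ => ?_
  have h1 := L.matB_code i j
  have h2 := List.getD_ofFn_fin y j 0
  rw [h1, h2]
  rfl

theorem num_mul_div_den (q : ℚ) {D : ℕ} (h : q.den ∣ D) :
    ((q.num * (D / q.den : ℕ) : ℤ) : ℚ) = D * q := by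
  have hd : (q.den : ℚ) ≠ 0 := by exact_mod_cast q.den_ne_zero
  rw [Int.cast_mul, Int.cast_natCast, Nat.cast_div h hd]
  conv_rhs => rw [← Rat.num_div_den q]
  field_simp

theorem cast_guardVal_code (i : Fin L.k) (y : Fin L.d → ℤ) :
    ((L.code.guardVal i (List.ofFn y) : ℤ) : ℚ) =
      L.code.den i * (L.B *ᵥ (fun j => (y j : ℚ)) + L.b) i := by
  have hb : (L.b i).den ∣ L.code.den i := by
    have : (L.code.vecB i).2 ∣ L.code.den i := Dvd.intro_left _ rfl
    rwa [vecB_code] at this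
  have hB : ∀ j, (L.B i j).den ∣ L.code.den i := fun j => by
    have : (L.code.matB i j).2 ∣ L.code.den i :=
      (Finset.dvd_prod_of_mem (fun j => (L.code.matB i j).2) (Finset.mem_range.2 j.2)).mul_right _
    rwa [matB_code] at this
  rw [guardVal_code, Int.cast_add, num_mul_div_den _ hb, Pi.add_apply, mul_add]
  congr 1
  simp only [dotProduct, Matrix.mulVec, Int.cast_sum, Finset.mul_sum, Int.cast_mul (_ : ℤ) (y _),
    intGuard]
  exact Finset.sum_congr rfl fun j _ => by rw [num_mul_div_den _ (hB j), mul_assoc]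

theorem guard_iff (y : Fin L.d → ℤ) :
    L.Guard y ↔ ∀ i : Fin L.k, 0 < L.code.guardVal i (List.ofFn y) := by
  refine forall_congr' fun i => ?_
  rw [← Int.cast_pos (R := ℚ), cast_guardVal_code,
    mul_pos_iff_of_pos_left (by exact_mod_cast L.den_code_pos i)]

theorem obs_code (i p : ℕ) (y : Fin L.d → ℤ) (n : ℕ) :
    L.code.obs i p (List.ofFn y) n = L.code.guardVal i (List.ofFn (L.update^[2 * n + p] y)) := by
  rw [LoopCode.obs, step_iterate_code]

/-! ### The recurrence for guard values and its consequences -/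

theorem update_iterate_succ_sub (y : Fin L.d → ℤ) (n : ℕ) :
    L.update^[n + 1] y - L.update^[n] y = L.A ^ n *ᵥ (L.update y - y) := by
  induction n with
  | zero => simp
  | succ n ih =>
    rw [pow_succ', ← Matrix.mulVec_mulVec, ← ih, Function.iterate_succ_apply' _ (n + 1),
      Function.iterate_succ_apply' _ n, Matrix.mulVec_sub]
    simp [update]

open Polynomial in
theorem newtonDiff_obs_eq_zero (hL : L.IsTriangular) (i : Fin L.k) (p : ℕ) (y : Fin L.d → ℤ) :
    ∀ n, newtonDiff L.code.root (L.code.obs i p (List.ofFn y)) L.code.numRoots n = 0 := by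
  have hsq : ∀ t : Fin L.d, L.A t t * L.A t t ≤
      ∑ i ∈ Finset.range L.code.1, L.code.matA i i * L.code.matA i i := by
    intro t
    rw [← L.matA_code t t]
    exact Finset.single_le_sum (f := fun i : ℕ => L.code.matA i i * L.code.matA i i)
      (fun i _ => mul_self_nonneg _) (Finset.mem_range.2 t.2)
  obtain ⟨q, hq⟩ := sub_one_mul_prod_diag_dvd (fun t => L.A t t * L.A t t)
    (N := (∑ i ∈ Finset.range L.code.1, L.code.matA i i * L.code.matA i i).toNat + 2)
    (fun t => mul_self_nonneg _) (fun t => by have := hsq t; omega) (by omega)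
  -- The factor `X - 1` removes the affine part and leaves a purely linear orbit of `A ^ 2`.
  have hdiff : aeval shiftEnd (X - C 1 : ℤ[X]) (L.code.obs i p (List.ofFn y)) =
      fun n => L.intGuard i ⬝ᵥ ((L.A ^ 2) ^ n *ᵥ
        (L.update^[p + 2] y - L.update^[p] y)) := by
    ext n
    simp only [map_sub, aeval_X, map_one, LinearMap.sub_apply, Pi.sub_apply, shiftEnd_apply,
      obs_code, guardVal_code, Module.End.one_apply]
    rw [add_sub_add_right_eq_sub, ← dotProduct_sub, ← pow_mul]
    have h2 : ∀ z : Fin L.d → ℤ, ∀ m, L.update^[m + 2] z - L.update^[m] z =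
        L.A ^ m *ᵥ (L.update^[2] z - z) := by
      intro z m
      have e1 := L.update_iterate_succ_sub z (m + 1)
      have e2 := L.update_iterate_succ_sub z m
      have e3 := L.update_iterate_succ_sub z 1
      rw [← sub_add_sub_cancel (L.update^[m + 2] z) (L.update^[m + 1] z), e1, e2, pow_succ,
        ← Matrix.mulVec_mulVec, ← Matrix.mulVec_add, ← pow_one L.A, ← e3]
      simp
    have h3 := h2 (L.update^[p] y) (2 * n)
    rw [← Function.iterate_add_apply, ← Function.iterate_add_apply,
      ← Function.iterate_add_apply] at h3
    rw [show 2 * (n + 1) + p = 2 * n + 2 + p by ring, h3, add_comm 2 p]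
  have hroot : ∀ j, L.code.root j = ((j / (L.d + 1) : ℕ) : ℤ) := fun j => rfl
  rw [newtonDiff_eq_aeval]
  simp only [hroot]
  rw [show L.code.numRoots = ((∑ i ∈ Finset.range L.code.1,
    L.code.matA i i * L.code.matA i i).toNat + 2) * (L.d + 1) from rfl, hq,
    mul_comm, mul_comm (X - C 1), ← mul_assoc, map_mul, Module.End.mul_apply, hdiff,
    aeval_shiftEnd_of_pow, map_mul, L.aeval_sq_prod_diag hL]
  simp

theorem root_mono : Monotone L.code.root := fun a b h => by
  unfold LoopCode.root
  exact_mod_cast Nat.div_le_div_right h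

theorem root_nonneg (j : ℕ) : 0 ≤ L.code.root j := Int.natCast_nonneg _

theorem root_eq_zero {j : ℕ} (h : j < L.d + 1) : L.code.root j = 0 := by
  unfold LoopCode.root
  exact_mod_cast Nat.div_eq_of_lt h

theorem one_le_root {j : ℕ} (h : L.d + 1 ≤ j) : 1 ≤ L.code.root j := by
  unfold LoopCode.root
  exact_mod_cast (Nat.one_le_div_iff (Nat.succ_pos _)).2 h

theorem eventuallyRuns_of_witness (hL : L.IsTriangular) {y : Fin L.d → ℤ}
    (hy : L.IsNonterminationWitness y) : L.code.EventuallyRuns (List.ofFn y) := by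
  intro i hi p _
  refine exists_lead_of_pos L.root_mono L.root_nonneg ?_ (fun j hj => L.root_eq_zero hj)
    (fun j hj => L.one_le_root hj) (L.newtonDiff_obs_eq_zero hL ⟨i, hi⟩ p y) fun n => ?_
  · exact Nat.le_mul_of_pos_left _ (by omega)
  · rw [obs_code]
    exact (L.guard_iff _).1 (hy _) ⟨i, hi⟩

theorem exists_witness_of_eventuallyRuns (hL : L.IsTriangular) {y : Fin L.d → ℤ}
    (hy : L.code.EventuallyRuns (List.ofFn y)) : ∃ c, L.IsNonterminationWitness c := by
  have hev : ∀ i : Fin L.k, ∀ p : Fin 2, ∃ N, ∀ n ≥ N,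
      0 < L.code.obs i p (List.ofFn y) n := by
    intro i p
    obtain ⟨j, hj, hdj, hpos, hz⟩ := hy i i.2 p p.2
    exact eventually_pos_of_lead L.root_mono L.root_nonneg hj
      (L.newtonDiff_obs_eq_zero hL i p y) (L.one_le_root hdj) hpos hz
  choose N hN using hev
  let K := ∑ i, ∑ p, N i p
  have hK : ∀ i p, N i p ≤ K := fun i p =>
    (Finset.single_le_sum (f := fun p => N i p) (fun _ _ => Nat.zero_le _)
      (Finset.mem_univ p)).trans (Finset.single_le_sum (f := fun i => ∑ p, N i p)
        (fun _ _ => Nat.zero_le _) (Finset.mem_univ i))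
  refine ⟨L.update^[2 * K] y, fun n => ?_⟩
  rw [guard_iff]
  intro i
  have h := hN i ⟨n % 2, Nat.mod_lt _ two_pos⟩ (K + n / 2) ((hK _ _).trans (Nat.le_add_right _ _))
  rw [obs_code] at h
  rw [← Function.iterate_add_apply]
  have hn : n + 2 * K = 2 * (K + n / 2) + n % 2 := by omega
  rwa [hn]

/-! ### Reduction to bounded starting points -/

theorem iterate_update_affine (n : ℕ) (w : Fin L.d → ℤ) :
    ∃ (v : Fin L.d → ℤ) (γ : ℤ), ∀ y, w ⬝ᵥ L.update^[n] y = v ⬝ᵥ y + γ := by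
  induction n generalizing w with
  | zero => exact ⟨w, 0, fun y => by simp⟩
  | succ n ih =>
    obtain ⟨v, γ, h⟩ := ih (w ᵥ* L.A)
    refine ⟨v, γ + w ⬝ᵥ L.a, fun y => ?_⟩
    rw [Function.iterate_succ_apply', update, dotProduct_add, Matrix.dotProduct_mulVec, h,
      add_assoc]

theorem lead_affine (i : Fin L.k) (p j : ℕ) : ∃ (v : Fin L.d → ℤ) (γ : ℤ), ∀ y,
    L.code.lead i p j (List.ofFn y) = v ⬝ᵥ y + γ := by
  suffices ∀ n, ∃ (v : Fin L.d → ℤ) (γ : ℤ), ∀ y,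
      newtonDiff L.code.root (L.code.obs i p (List.ofFn y)) j n = v ⬝ᵥ y + γ from this 0
  induction j with
  | zero =>
    intro n
    obtain ⟨v, γ, h⟩ := L.iterate_update_affine (2 * n + p) (L.intGuard i)
    refine ⟨v, γ + (L.b i).num * (L.code.den i / (L.b i).den : ℕ), fun y => ?_⟩
    rw [newtonDiff, obs_code, guardVal_code, h, add_assoc]
  | succ j ih =>
    intro n
    obtain ⟨v, γ, h⟩ := ih (n + 1)
    obtain ⟨v', γ', h'⟩ := ih n
    refine ⟨v - L.code.root j • v', γ - L.code.root j * γ', fun y => ?_⟩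
    change newtonDiff _ _ j (n + 1) - L.code.root j * newtonDiff _ _ j n = _
    rw [h, h', sub_dotProduct, smul_dotProduct, smul_eq_mul]
    ring

theorem unitVec_code (s : Fin L.d) : L.code.unitVec s = List.ofFn (Pi.single s (1 : ℤ)) := by
  rw [LoopCode.unitVec, map_range_dim]
  congr 1
  ext t
  simp [Pi.single_apply, Fin.ext_iff]

theorem unitVec_code_dim : L.code.unitVec L.code.1 = List.ofFn (0 : Fin L.d → ℤ) := by
  rw [LoopCode.unitVec, map_range_dim]
  congr 1
  ext t
  exact if_neg t.2.ne

/-- The values at zero and at the unit vectors are `γ` and `v s + γ`, which bounds `v`. The spare 1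
leaves room for the constant `γ - 1` that encodes strict positivity. -/
theorem exists_lead_coeffs (i : Fin L.k) {p j : ℕ} (hp : p < 2) (hj : j < L.code.numRoots) :
    ∃ (v : Fin L.d → ℤ) (γ : ℤ), (∀ s, |v s| ≤ L.code.coeffBound) ∧
      |γ| + 1 ≤ L.code.coeffBound ∧ ∀ y, L.code.lead i p j (List.ofFn y) = v ⬝ᵥ y + γ := by
  obtain ⟨v, γ, h⟩ := L.lead_affine i p j
  have h0 : L.code.lead i p j (L.code.unitVec L.code.1) = γ := by
    rw [unitVec_code_dim, h, dotProduct_zero, zero_add]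
  have hs : ∀ s : Fin L.d, L.code.lead i p j (L.code.unitVec s) = v s + γ := fun s => by
    rw [unitVec_code, h, dotProduct_single, mul_one]
  let F : ℕ → ℕ → ℕ → ℤ := fun i p j => |L.code.lead i p j (L.code.unitVec L.code.1)| +
    ∑ s ∈ Finset.range L.code.1, |L.code.lead i p j (L.code.unitVec s)|
  have hF : ∀ i p j, 0 ≤ F i p j := fun i p j =>
    add_nonneg (abs_nonneg _) (Finset.sum_nonneg fun _ _ => abs_nonneg _)
  have hle : F i p j + 1 ≤ L.code.coeffBound := by
    have h1 : F i p j ≤ ∑ i ∈ Finset.range L.code.2.1, ∑ p ∈ Finset.range 2,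
        ∑ j ∈ Finset.range L.code.numRoots, F i p j :=
      (Finset.single_le_sum (f := fun j => F i p j) (fun _ _ => hF _ _ _)
        (Finset.mem_range.2 hj)).trans <|
      (Finset.single_le_sum (f := fun p => ∑ j ∈ Finset.range L.code.numRoots, F i p j)
        (fun _ _ => Finset.sum_nonneg fun _ _ => hF _ _ _) (Finset.mem_range.2 hp)).trans <|
      Finset.single_le_sum (f := fun i => ∑ p ∈ Finset.range 2,
        ∑ j ∈ Finset.range L.code.numRoots, F i p j)
        (fun _ _ => Finset.sum_nonneg fun _ _ => Finset.sum_nonneg fun _ _ => hF _ _ _)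
        (Finset.mem_range.2 i.2)
    have h2 := Int.self_le_toNat (∑ i ∈ Finset.range L.code.2.1, ∑ p ∈ Finset.range 2,
        ∑ j ∈ Finset.range L.code.numRoots, F i p j)
    have h3 : (L.code.coeffBound : ℤ) = (∑ i ∈ Finset.range L.code.2.1, ∑ p ∈ Finset.range 2,
        ∑ j ∈ Finset.range L.code.numRoots, F i p j).toNat + 1 := by
      rw [LoopCode.coeffBound]; push_cast; rfl
    linarith
  simp only [F, h0] at hle
  refine ⟨v, γ, fun s => ?_, ?_, h⟩
  · have h1 := Finset.single_le_sum (f := fun s : ℕ => |L.code.lead i p j (L.code.unitVec s)|)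
      (fun _ _ => abs_nonneg _) (Finset.mem_range.2 (show (s : ℕ) < L.code.1 from s.2))
    simp only [hs] at h1
    have h2 : |v s| ≤ |v s + γ| + |γ| := by simpa using abs_sub (v s + γ) γ
    linarith
  · have h1 : 0 ≤ ∑ s ∈ Finset.range L.code.1, |L.code.lead i p j (L.code.unitVec s)| :=
      Finset.sum_nonneg fun _ _ => abs_nonneg _
    linarith

theorem exists_small_eventuallyRuns {x : Fin L.d → ℤ}
    (hx : L.code.EventuallyRuns (List.ofFn x)) : ∃ y : Fin L.d → ℤ,
      (∀ s, |y s| ≤ L.code.searchBound) ∧ L.code.EventuallyRuns (List.ofFn y) := by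
  have hx' : ∀ i : Fin L.k, ∀ p : Fin 2, ∃ j < L.code.numRoots, L.d + 1 ≤ j ∧
      0 < L.code.lead i p j (List.ofFn x) ∧
      ∀ j' < L.code.numRoots, j < j' → L.code.lead i p j' (List.ofFn x) = 0 :=
    fun i p => hx i i.2 p p.2
  choose J hJ hdJ hpos hz using hx'
  -- All inequalities with bounded coefficients valid at `x`: this includes every needed one,
  -- equations entering as two opposite inequalities.
  let S : Set ((Fin L.d → ℤ) × ℤ) := {q | (∀ s, |q.1 s| ≤ L.code.coeffBound) ∧
    |q.2| ≤ L.code.coeffBound ∧ 0 ≤ q.1 ⬝ᵥ x + q.2}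
  obtain ⟨y, hy, hyS⟩ := exists_small_solution L.d L.d le_rfl L.code.coeffBound S
    (fun q hq => ⟨hq.1, hq.2.1⟩) x (fun q hq => hq.2.2)
  refine ⟨y, hy, fun i hi p hp => ⟨J ⟨i, hi⟩ ⟨p, hp⟩, hJ _ _, hdJ _ _, ?_, fun j' hj' hlt => ?_⟩⟩
  · obtain ⟨v, γ, hv, hγ, h⟩ := L.exists_lead_coeffs ⟨i, hi⟩ hp (hJ ⟨i, hi⟩ ⟨p, hp⟩)
    have h1 := hpos ⟨i, hi⟩ ⟨p, hp⟩
    simp only [h] at h1 ⊢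
    have h2 := hyS (v, γ - 1) ⟨hv, (abs_sub _ _).trans (by simpa using hγ), by simp only; omega⟩
    simp only at h2
    omega
  · obtain ⟨v, γ, hv, hγ, h⟩ := L.exists_lead_coeffs ⟨i, hi⟩ hp hj'
    have h1 := hz ⟨i, hi⟩ ⟨p, hp⟩ j' hj' hlt
    simp only [h] at h1 ⊢
    have h2 := hyS (v, γ) ⟨hv, by simp only; omega, by simp only; omega⟩
    have h3 := hyS (-v, -γ) ⟨fun s => by simpa using hv s, by simp only [abs_neg]; omega,
      by simp only [neg_dotProduct]; omega⟩
    simp only [neg_dotProduct] at h2 h3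
    omega

theorem exists_digitVec_eq {H : ℕ} {y : Fin L.d → ℤ} (hy : ∀ s, |y s| ≤ H) :
    ∃ e < (2 * H + 1) ^ L.d, L.code.digitVec H e = List.ofFn y := by
  let f : Fin L.d → Fin (2 * H + 1) := fun s =>
    ⟨(y s + H).toNat, by have := abs_le.1 (hy s); omega⟩
  refine ⟨finFunctionFinEquiv f, (finFunctionFinEquiv f).2, ?_⟩
  rw [LoopCode.digitVec, map_range_dim]
  congr 1
  ext s
  have h1 : (finFunctionFinEquiv f : ℕ) / (2 * H + 1) ^ (s : ℕ) % (2 * H + 1) = f s := by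
    conv_rhs => rw [← finFunctionFinEquiv.symm_apply_apply f]
    rfl
  rw [h1]
  have := abs_le.1 (hy s)
  simp only [f]
  omega

theorem searchSucceeds_iff (hL : L.IsTriangular) :
    L.code.SearchSucceeds ↔ ∃ c, L.IsNonterminationWitness c := by
  constructor
  · rintro ⟨e, _, he⟩
    rw [LoopCode.digitVec, map_range_dim] at he
    exact L.exists_witness_of_eventuallyRuns hL he
  · rintro ⟨x, hx⟩
    obtain ⟨y, hy, hrun⟩ := L.exists_small_eventuallyRuns (L.eventuallyRuns_of_witness hL hx)
    obtain ⟨e, he, hey⟩ := L.exists_digitVec_eq hy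
    exact ⟨e, he, hey ▸ hrun⟩

end AffineLoop

/-- Termination of triangular affine integer loops is decidable: a single (total) computable
function, given the code of any triangular loop of any dimension, answers correctly whether the
loop terminates. -/
theorem mainTheorem1 :
    ∃ D : LoopCode → Bool, Computable D ∧
      ∀ L : AffineLoop, L.IsTriangular → (D L.code = true ↔ L.Terminates) := by
  classical
  refine ⟨fun c => !decide c.SearchSucceeds, (Primrec.not.comp
    (primrecPred_iff_primrec_decide.1 LoopCode.primrecPred_searchSucceeds)).to_comp,
    fun L hL => ?_⟩
  rw [Bool.not_eq_true', decide_eq_false_iff_not, L.searchSucceeds_iff hL, AffineLoop.Terminates]
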